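/- **Setting.** Let $K,N,M\ge 1$. A primary transmitter with $N$ antennas reaches $K$ secondary transmitters through random channel vectors $\mathbf h_1,\dots,\mathbf h_K\in\mathbb C^N$. The selected secondary transmitter $\mathrm{ST_b}$ is one that maximizes $\|\mathbf h_k\|^2$; put $X=\max_k\|\mathbf h_k\|^2$. It serves $M+1$ receivers (index $0$: the primary receiver; index $i\in\{1,\dots,M\}$: the secondary receiver $\mathrm{SR}_i$) through complex channel coefficients $g_0,\dots,g_M$; after sorting, $G_0\le G_1\le\dots\le G_M$ are the values $|g_0|^2,\dots,|g_M|^2$ in increasing order, and $G_i$ is the gain of receiver $i$. The fading is Rayleigh: all scalar coefficients are independent, each entry of each $\mathbf h_k$ has exponential squared modulus with mean $\lambda_{ps}>0$, and each $|g_i|^2$ is exponential with mean $\lambda_{sr}>0$. Let $0<\eta\le1$, $0<\beta<1$, $0<\xi\le1$, $0<\psi<1$, $I_{SI}\ge0$ with $\eta\beta\xi\psi I_{SI}<1$, let $\bar\gamma>0$ be the transmit SNR, $\rho=\frac{\eta\beta\xi\psi}{1-\eta\beta\xi\psi I_{SI}}$, let $\alpha_0\ge\dots\ge\alpha_M\ge0$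 with $\sum_i\alpha_i=1$ be the power allocation coefficients and $\bar R_0,\dots,\bar R_M>0$ the target rates, $\gamma_i=2^{\bar R_i}-1$. The rate at which $\mathrm{ST_b}$ decodes the primary signal $x_0$ is $$R_{s_b,x_0}=\log_2\Big(1+\tfrac{(1-\beta)\bar\gamma X}{(1-\beta)\rho\bar\gamma I_{SI}X+1}\Big),$$ and the rate at which $\mathrm{SR}_m$ decodes $x_{m'}$ by successive interference cancellation is $$R_{r_m,x_{m'}}=\log_2\Big(1+\tfrac{\alpha_{m'}\rho\bar\gamma XG_m}{\sum_{i=m'+1}^M\alpha_i\rho\bar\gamma XG_m+1}\Big).$$ For $1\le m\le M$ the outage probability of $\mathrm{SR}_m$ is $$P_{r_m}=\Pr(R_{s_b,x_0}<\bar R_0)+\Pr\big(R_{s_b,x_0}\ge\bar R_0,\ R_{r_m,x_{m'}}<\bar R_{m'}\text{ for some }0\le m'\le m\big).$$ Put $Q=M+1$, $q=m+1$, $\iota_q=\frac{Q!}{(q-1)!(Q-q)!}$, $\mu=\frac{\gamma_0}{(1-\beta)(1-\gamma_0\rho I_{SI})}$, $\Theta_{m'}=\frac{\gamma_{m'}}{\rho(\alpha_{m'}-\gamma_{m'}\sum_{i=m'+1}^M\alpha_i)}$,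 $\Theta=\max(\Theta_0,\dots,\Theta_m)$, $\Gamma(s,x)=\int_x^\infty t^{s-1}e^{-t}\,dt$. For each $l$ let $C_0=1$, $C_1=l$, $C_j=\frac1j\sum_{p=1}^{\min(j,N-1)}\frac{pl-j+p}{p!}C_{j-p}$ for $j\ge2$ (these depend on $l$ and $N$). For a function $E$ put $$\mathcal F_E(x)=\iota_q\sum_{c=0}^{Q-q}\binom{Q-q}{c}\frac{(-1)^c}{q+c}\sum_{n=0}^{q+c}\binom{q+c}{n}(-1)^nE\Big(\frac{nx}{\lambda_{sr}}\Big).$$ **Theorem.** Let $1\le m\le M$. 1. If $\gamma_0\rho I_{SI}\ge1$, or $\gamma_{m'}\sum_{i=m'+1}^M\alpha_i\ge\alpha_{m'}$ for some $0\le m'\le m$, then $P_{r_m}=1$. 2. Otherwise $P_{r_m}\approx\widehat P_{r_m}$, where $$\begin{aligned}\widehat P_{r_m}={}&\sum_{l=0}^K\binom Kl(-1)^le^{-\frac{l\mu}{\lambda_{ps}\bar\gamma}}\sum_{j=0}^{l(N-1)}C_j\Big(\frac{\mu}{\lambda_{ps}\bar\gamma}\Big)^j\\&+\iota_q\sum_{c=0}^{Q-q}\sum_{n=0}^{q+c}\sum_{l=1}^K\sum_{j=0}^{l(N-1)}\binom{Q-q}c\binom{q+c}n\binom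 Kl\frac{(-1)^{c+n+l}}{q+c}\frac{C_j}{l^j}\\&\times\Big[\Big(j+\tfrac{n\Theta l}{\lambda_{sr}\lambda_{ps}\bar\gamma}\Big)\Gamma\Big(j,\tfrac{l\mu}{\lambda_{ps}\bar\gamma}\Big)-\Gamma\Big(j+1,\tfrac{l\mu}{\lambda_{ps}\bar\gamma}\Big)-\tfrac{n\Theta jl}{\lambda_{sr}\lambda_{ps}\bar\gamma}\Gamma\Big(j-1,\tfrac{l\mu}{\lambda_{ps}\bar\gamma}\Big)\Big],\end{aligned}$$ in the following precise sense. Exactly, $$P_{r_m}=\Pr\Big(X<\frac\mu{\bar\gamma}\Big)+\mathbb E\Big[\mathcal F_E\Big(\frac{\Theta}{\bar\gamma X}\Big);\,X\ge\frac\mu{\bar\gamma}\Big]\quad\text{with }E(u)=e^{-u},$$ and $\widehat P_{r_m}$ is exactly the value of the same right-hand side with $E(u)=1-u$, that is, with every $e^{-n\Theta/(\lambda_{sr}\bar\gamma X)}$ replaced by $1-\frac{n\Theta}{\lambda_{sr}\bar\gamma X}$. The error of the approximation satisfies $$0\le P_{r_m}-\widehat P_{r_m}\le\binom{M+1}{m+1}\,\mathbb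 E\Big[\Big(\frac{\Theta}{\lambda_{sr}\bar\gamma X}\Big)^{m+1};\,X\ge\frac\mu{\bar\gamma}\Big]$$ and also $P_{r_m}-\widehat P_{r_m}\le\binom{M+1}{m+1}\Big(\frac{\Theta}{\lambda_{sr}\mu}\Big)^{m+1}$. -/

import Mathlib

open MeasureTheory ProbabilityTheory

noncomputable section

namespace CoopNOMA

/-- Upper incomplete gamma function `Γ(s, x) = ∫_x^∞ t^(s-1) e^(-t) dt` (`x > 0`, `s` real). -/
def upperGamma (s x : ℝ) : ℝ :=
  ∫ t in Set.Ioi x, t ^ (s - 1) * Real.exp (-t)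

/-- The coefficients `C_j` (depending on `N` and `l`): `C_0 = 1`, `C_1 = l`, and
`C_j = (1/j) ∑_{p=1}^{min(j, N-1)} ((p l - j + p) / p!) C_{j-p}` for `j ≥ 2`.
Below the summation index is `p - 1`. -/
def coeffC (N l : ℕ) : ℕ → ℝ
  | 0 => 1
  | 1 => l
  | (j + 2) => (1 / ((j : ℝ) + 2)) * ∑ p ∈ Finset.range (min (j + 2) (N - 1)),
      ((((p : ℝ) + 1) * l - ((j : ℝ) + 2) + ((p : ℝ) + 1)) / (Nat.factorial (p + 1) : ℝ)) *
        coeffC N l (j + 1 - p)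
  termination_by j => j
  decreasing_by omega

/-- `ι_q = Q! / ((q-1)! (Q-q)!)`. -/
def iota (Q q : ℕ) : ℝ :=
  (Nat.factorial Q : ℝ) / ((Nat.factorial (q - 1) : ℝ) * (Nat.factorial (Q - q) : ℝ))

/-- The sum
`ι_q ∑_{c=0}^{Q-q} binom(Q-q, c) ((-1)^c / (q+c)) ∑_{n=0}^{q+c} binom(q+c, n) (-1)^n E(n x / lam)`.
With `E u = exp (-u)` this is the distribution function at `x ≥ 0` of the `q`-th smallest of `Q`
independent exponential variables of mean `lam`. -/
def orderStatSum (E : ℝ → ℝ) (Q q : ℕ) (lam x : ℝ) : ℝ :=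
  iota Q q * ∑ c ∈ Finset.range (Q - q + 1),
    ((Q - q).choose c : ℝ) * ((-1) ^ c / ((q : ℝ) + c)) *
      ∑ n ∈ Finset.range (q + c + 1), ((q + c).choose n : ℝ) * (-1) ^ n * E (n * x / lam)

/-- Parameters of the network: `K` secondary transmitters, `N` antennas at the primary
transmitter, `M` secondary receivers. Receiver `0` is the primary receiver, receiver `i` with
`1 ≤ i ≤ M` is the `i`-th secondary receiver. -/
structure Network (K N M : ℕ) where
  /-- energy conversion efficiency -/
  eta : ℝ
  /-- power splitting coefficient -/
  beta : ℝ
  /-- portion of the harvested power used by the power amplifier -/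
  xi : ℝ
  /-- energy utilization efficiency -/
  psi : ℝ
  /-- residual self-interference channel gain -/
  ISI : ℝ
  /-- transmit signal-to-noise ratio -/
  snr : ℝ
  /-- mean gain of each primary transmitter antenna to secondary transmitter link -/
  lamPS : ℝ
  /-- mean gain of the links from the selected secondary transmitter to the receivers -/
  lamSR : ℝ
  /-- power allocation coefficients -/
  alpha : Fin (M + 1) → ℝ
  /-- target data rates -/
  target : Fin (M + 1) → ℝ
  K_pos : 0 < K
  N_pos : 0 < N
  eta_pos : 0 < eta
  eta_le : eta ≤ 1
  beta_pos : 0 < beta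
  beta_lt : beta < 1
  xi_pos : 0 < xi
  xi_le : xi ≤ 1
  psi_pos : 0 < psi
  psi_lt : psi < 1
  ISI_nonneg : 0 ≤ ISI
  /-- the power balance at the selected transmitter has a positive solution -/
  balance : eta * beta * xi * psi * ISI < 1
  snr_pos : 0 < snr
  lamPS_pos : 0 < lamPS
  lamSR_pos : 0 < lamSR
  alpha_nonneg : ∀ i, 0 ≤ alpha i
  alpha_sum : ∑ i, alpha i = 1
  alpha_antitone : Antitone alpha
  target_pos : ∀ i, 0 < target i

namespace Network

variable {K N M : ℕ} {Ω : Type*}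

/-- `ρ = η β ξ ψ / (1 - η β ξ ψ I_SI)`; the selected transmitter sends with power
`ρ P_s ‖h_{ps_b}‖²`. -/
def rho (S : Network K N M) : ℝ :=
  S.eta * S.beta * S.xi * S.psi / (1 - S.eta * S.beta * S.xi * S.psi * S.ISI)

/-- Target SINR `γ_i = 2^(target rate) - 1`. -/
def gam (S : Network K N M) (i : Fin (M + 1)) : ℝ := (2 : ℝ) ^ S.target i - 1

/-- `μ = γ_0 / ((1 - β) (1 - γ_0 ρ I_SI))`. -/
def mu (S : Network K N M) : ℝ :=
  S.gam 0 / ((1 - S.beta) * (1 - S.gam 0 * S.rho * S.ISI))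

/-- `Θ_i = γ_i / (ρ (α_i - γ_i ∑_{k > i} α_k))`. -/
def thetaAt (S : Network K N M) (i : Fin (M + 1)) : ℝ :=
  S.gam i / (S.rho * (S.alpha i - ∑ k ∈ Finset.Ioi i, S.alpha k * S.gam i))

/-- `Θ = max (Θ_0, …, Θ_m)`. -/
def theta (S : Network K N M) (m : Fin (M + 1)) : ℝ :=
  (Finset.Iic m).sup' Finset.nonempty_Iic S.thetaAt

/-- The target rates are compatible with the self-interference and the power allocation:
`γ_0 < 1 / (ρ I_SI)`, and `γ_i < α_i / ∑_{k > i} α_k` for all `i ≤ m` (written without division,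
so that a vanishing denominator counts as an infinite right-hand side when `α_i > 0`). -/
def Feasible (S : Network K N M) (m : Fin (M + 1)) : Prop :=
  S.gam 0 * (S.rho * S.ISI) < 1 ∧
    ∀ i ≤ m, S.gam i * ∑ k ∈ Finset.Ioi i, S.alpha k < S.alpha i

/-- The closed-form approximation of the outage probability of receiver `m`
(with `Q = M + 1` and `q = m + 1`). -/
def outageApprox (S : Network K N M) (m : Fin (M + 1)) : ℝ :=
  let Q : ℕ := M + 1
  let q : ℕ := (m : ℕ) + 1
  let y : ℝ := S.mu / (S.lamPS * S.snr)
  let t : ℝ := S.theta m / (S.lamSR * S.lamPS * S.snr)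
  (∑ l ∈ Finset.range (K + 1), (K.choose l : ℝ) * (-1) ^ l * Real.exp (-(l * y)) *
      ∑ j ∈ Finset.range (l * (N - 1) + 1), coeffC N l j * y ^ j) +
  iota Q q *
    ∑ c ∈ Finset.range (Q - q + 1), ∑ n ∈ Finset.range (q + c + 1),
      ∑ l ∈ Finset.Icc 1 K, ∑ j ∈ Finset.range (l * (N - 1) + 1),
        (((Q - q).choose c : ℝ) * ((q + c).choose n : ℝ) * (K.choose l : ℝ)) *
        ((-1) ^ (c + n + l) / ((q : ℝ) + c)) * (coeffC N l j / (l : ℝ) ^ j) *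
        (((j : ℝ) + n * t * l) * upperGamma j (l * y)
          - upperGamma ((j : ℝ) + 1) (l * y)
          - n * t * j * l * upperGamma ((j : ℝ) - 1) (l * y))

/-- Rayleigh fading. `h k` is the channel vector from the primary transmitter to the `k`-th
secondary transmitter, `b` is the selected secondary transmitter (one with the largest channel
gain), and `g i` are the (unsorted) channel coefficients from the selected transmitter to the
`M + 1` receivers. All scalar coefficients are independent, and their squared moduli are
exponential (rate = inverse of the mean), that is, their moduli are Rayleigh distributed. -/
structure RayleighModel [MeasurableSpace Ω] (S : Network K N M) (P : Measure Ω)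
    (h : Fin K → Ω → EuclideanSpace ℂ (Fin N)) (g : Fin (M + 1) → Ω → ℂ) (b : Ω → Fin K) :
    Prop where
  measurable_h : ∀ k, Measurable (h k)
  measurable_g : ∀ i, Measurable (g i)
  law_h : ∀ k n, P.map (fun ω => ‖h k ω n‖ ^ 2) = expMeasure (1 / S.lamPS)
  law_g : ∀ i, P.map (fun ω => ‖g i ω‖ ^ 2) = expMeasure (1 / S.lamSR)
  indep : iIndepFun
    (fun (i : (Fin K × Fin N) ⊕ Fin (M + 1)) (ω : Ω) =>
      Sum.elim (fun p : Fin K × Fin N => h p.1 ω p.2) (fun r => g r ω) i) P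
  best : ∀ ω k, ‖h k ω‖ ^ 2 ≤ ‖h (b ω) ω‖ ^ 2

/-- Channel gain `‖h_{ps_b}‖²` of the selected secondary transmitter. -/
def bestGain (h : Fin K → Ω → EuclideanSpace ℂ (Fin N)) (b : Ω → Fin K) (ω : Ω) : ℝ :=
  ‖h (b ω) ω‖ ^ 2

/-- Gains towards the receivers after sorting in increasing order: receiver `0` (primary) has the
smallest gain and the `m`-th secondary receiver the `(m+1)`-th smallest one. -/
def sortedGain (g : Fin (M + 1) → Ω → ℂ) (m : Fin (M + 1)) (ω : Ω) : ℝ :=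
  ‖g (Tuple.sort (fun i => ‖g i ω‖ ^ 2) m) ω‖ ^ 2

/-- Rate at which the selected transmitter decodes the primary signal, for first-hop gain `x`. -/
def rateST (S : Network K N M) (x : ℝ) : ℝ :=
  Real.logb 2 (1 + (1 - S.beta) * S.snr * x /
    ((1 - S.beta) * S.rho * S.snr * S.ISI * x + 1))

/-- Rate at which a receiver decodes the signal `i` after cancelling the signals `0, …, i-1`,
for first-hop gain `x` and second-hop gain `z`. -/
def rateRx (S : Network K N M) (i : Fin (M + 1)) (x z : ℝ) : ℝ :=
  Real.logb 2 (1 + S.alpha i * S.rho * S.snr * x * z /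
    (∑ k ∈ Finset.Ioi i, S.alpha k * S.rho * S.snr * x * z + 1))

/-- Outage probability of receiver `m`: the selected transmitter fails to decode the primary
signal, or it decodes it and receiver `m` fails to decode some signal `i ≤ m`. -/
def outageProb [MeasurableSpace Ω] (S : Network K N M) (P : Measure Ω)
    (h : Fin K → Ω → EuclideanSpace ℂ (Fin N)) (g : Fin (M + 1) → Ω → ℂ) (b : Ω → Fin K)
    (m : Fin (M + 1)) : ℝ :=
  P.real {ω | S.rateST (bestGain h b ω) < S.target 0} +
  P.real {ω | S.target 0 ≤ S.rateST (bestGain h b ω) ∧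
    ∃ i ≤ m, S.rateRx i (bestGain h b ω) (sortedGain g m ω) < S.target i}

end Network

end CoopNOMA

end

/-! The linearized correction is identically zero. For `k ≥ 2` the alternating sum of `binom(k,n)
(-1)^n (a + n b)` vanishes, being a `k`-th finite difference of a polynomial of degree at most one
(`sum_choose_neg_one_pow_mul_linear`). Here `k = q + c` with `q = m + 1 ≥ 2`, so replacing `e^{-u}`
by `1 - u` annihilates the order statistics sum (`orderStatSum_linear`). The bracket of incomplete
gamma values in the closed form is affine in `n`, so the whole quadruple sum is zero too, and no
gamma integral has to be evaluated (`outageApprox_eq`).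

What remains of the closed form is `Pr(X < μ/snr)`. The gain of one transmitter is a sum of `N`
exponentials, hence Erlang (`measureReal_sum_lt`), and the maximum of `K` independent ones has the
`K`-th power as distribution function. Its binomial expansion involves powers of the truncated
exponential series, whose coefficients are the `C_j` (`coeff_truncExp_pow`).

The error is therefore the full second-hop term, the expectation of the order statistics
distribution function. That function is a binomial tail at `F = 1 - e^{-x/λ}` (`orderStatSum_exp`),
which lies between `0` and `binom(Q,q) F^q` (`binomTail_le`), and `F ≤ x/λ`. -/

noncomputable section

namespace CoopNOMA

/-! ### The `C_j` as coefficients of powers of the truncated exponential. -/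

/-- The truncated exponential series of degree `< N`. -/
def truncExp (N : ℕ) : Polynomial ℝ :=
  ∑ p ∈ Finset.range N, Polynomial.C (1 / (p.factorial : ℝ)) * Polynomial.X ^ p

lemma coeff_truncExp (N p : ℕ) :
    (truncExp N).coeff p = if p < N then 1 / (p.factorial : ℝ) else 0 := by
  simp [truncExp, Polynomial.finsetSum_coeff, Polynomial.coeff_X_pow]

lemma natDegree_truncExp_le (N : ℕ) : (truncExp N).natDegree ≤ N - 1 := by
  rw [Polynomial.natDegree_le_iff_coeff_eq_zero]
  intro p hp
  rw [coeff_truncExp, if_neg (by omega)]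

lemma eval_truncExp (N : ℕ) (x : ℝ) :
    (truncExp N).eval x = ∑ p ∈ Finset.range N, x ^ p / (p.factorial : ℝ) := by
  simp only [truncExp, Polynomial.eval_finsetSum, Polynomial.eval_mul, Polynomial.eval_C,
    Polynomial.eval_pow, Polynomial.eval_X]
  exact Finset.sum_congr rfl fun p _ => by ring

/-- Logarithmic derivative of `A ^ l` with denominators cleared; the factor `X` keeps coefficient
indices unshifted. -/
lemma mul_derivative_pow {R : Type*} [CommRing R] (A : Polynomial R) (l : ℕ) :
    A * (Polynomial.X * Polynomial.derivative (A ^ l)) =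
      (l : Polynomial R) * ((Polynomial.X * Polynomial.derivative A) * A ^ l) := by
  cases l with
  | zero => simp
  | succ l =>
    rw [Polynomial.derivative_pow]
    simp only [Nat.add_sub_cancel, map_natCast, pow_succ]
    push_cast
    ring

lemma coeff_X_mul_derivative {R : Type*} [CommRing R] (A : Polynomial R) (j : ℕ) :
    (Polynomial.X * Polynomial.derivative A).coeff j = j * A.coeff j := by
  cases j with
  | zero => simp
  | succ j => rw [Polynomial.coeff_X_mul, Polynomial.coeff_derivative]; push_cast; ring

/-- Compares coefficients of `X^j` in `mul_derivative_pow`: the weight is `p l - (j - p)`. The term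
`p = 0` carries the `j`-th coefficient of `A ^ l`, so the identity can be solved for it. -/
lemma sum_coeff_pow_recurrence {R : Type*} [CommRing R] (A : Polynomial R) (l j : ℕ) :
    ∑ p ∈ Finset.range (j + 1),
      ((p : R) * l - j + p) * A.coeff p * (A ^ l).coeff (j - p) = 0 := by
  have h := congrArg (fun B => Polynomial.coeff B j) (mul_derivative_pow A l)
  simp only [Polynomial.coeff_natCast_mul] at h
  rw [Polynomial.coeff_mul, Polynomial.coeff_mul,
    Finset.Nat.sum_antidiagonal_eq_sum_range_succ_mk,
    Finset.Nat.sum_antidiagonal_eq_sum_range_succ_mk] at h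
  simp only [coeff_X_mul_derivative, Finset.mul_sum] at h
  rw [← sub_eq_zero, ← Finset.sum_sub_distrib] at h
  rw [← neg_eq_zero, ← Finset.sum_neg_distrib, ← h]
  refine Finset.sum_congr rfl fun p hp => ?_
  rw [Nat.cast_sub (by simpa [Nat.lt_succ_iff] using hp)]
  ring

/-- `N ≥ 2` is needed: for `N = 1` the polynomial is `1`, while `coeffC 1 l 1 = l`. -/
lemma coeff_truncExp_pow {N : ℕ} (hN : 2 ≤ N) (l j : ℕ) :
    (truncExp N ^ l).coeff j = coeffC N l j := by
  have h0 : (truncExp N).coeff 0 = 1 := by simp [coeff_truncExp]; omega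
  induction j using Nat.strong_induction_on with
  | _ j ih =>
    match j, ih with
    | 0, _ => rw [Polynomial.coeff_zero_eq_eval_zero, Polynomial.eval_pow,
        ← Polynomial.coeff_zero_eq_eval_zero, h0, coeffC]; simp
    | 1, ih =>
      have h := sum_coeff_pow_recurrence (truncExp N) l 1
      have h1 : (truncExp N).coeff 1 = 1 := by simp [coeff_truncExp]; omega
      have hz := ih 0 (by norm_num)
      simp [Finset.sum_range_succ, h0, h1, hz, coeffC] at h
      rw [coeffC]; linarith
    | j + 2, ih =>
      have h := sum_coeff_pow_recurrence (truncExp N) l (j + 2)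
      rw [Finset.sum_range_succ', h0] at h
      have hj : (0 : ℝ) < (j : ℝ) + 2 := by positivity
      have hs : ∑ p ∈ Finset.range (j + 2), (((p + 1 : ℕ) : ℝ) * l - (j + 2 : ℕ) + (p + 1 : ℕ)) *
            (truncExp N).coeff (p + 1) * (truncExp N ^ l).coeff (j + 2 - (p + 1)) =
          ∑ p ∈ Finset.range (min (j + 2) (N - 1)),
            ((((p : ℝ) + 1) * l - ((j : ℝ) + 2) + ((p : ℝ) + 1)) /
              (Nat.factorial (p + 1) : ℝ)) * coeffC N l (j + 1 - p) := by
        -- Coefficients of `truncExp N` of index `p + 1 ≥ N` vanish, which accounts for the `min` in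
        -- the recurrence.
        symm
        refine Finset.sum_subset_zero_on_sdiff ?_ ?_ ?_
        · exact Finset.range_mono (min_le_left _ _)
        · intro p hp
          have : ¬ (p + 1 < N) := by
            simp only [Finset.mem_sdiff, Finset.mem_range, lt_min_iff, not_and, not_lt] at hp
            have := hp.2 hp.1
            omega
          rw [coeff_truncExp, if_neg this]; simp
        · intro p hp
          simp only [Finset.mem_range, lt_min_iff] at hp
          rw [coeff_truncExp, if_pos (by omega), show j + 2 - (p + 1) = j + 1 - p by omega,
            ih (j + 1 - p) (by omega)]
          push_cast
          ring
      rw [hs] at h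
      rw [coeffC]
      push_cast at h
      rw [one_div, ← div_eq_inv_mul, eq_div_iff hj.ne']
      linarith

lemma sum_pow_div_factorial_pow {N : ℕ} (hN : 0 < N) (l : ℕ) (x : ℝ) :
    (∑ p ∈ Finset.range N, x ^ p / (p.factorial : ℝ)) ^ l =
      ∑ j ∈ Finset.range (l * (N - 1) + 1), coeffC N l j * x ^ j := by
  rcases Nat.lt_or_ge 1 N with h | h
  · rw [← eval_truncExp, ← Polynomial.eval_pow,
      Polynomial.eval_eq_sum_range' (n := l * (N - 1) + 1)]
    · simp only [coeff_truncExp_pow h]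
    · exact Nat.lt_succ_of_le
        (Polynomial.natDegree_pow_le.trans (Nat.mul_le_mul_left _ (natDegree_truncExp_le N)))
  -- For `N = 1` only the index `j = 0` occurs, so the mismatch at `j = 1` is harmless.
  · obtain rfl : N = 1 := by omega
    simp [coeffC]

/-! ### Alternating binomial sums. -/

lemma sum_choose_neg_one_pow_mul_exp (k : ℕ) (u : ℝ) :
    ∑ n ∈ Finset.range (k + 1), (k.choose n : ℝ) * (-1) ^ n * Real.exp (-(n * u)) =
      (1 - Real.exp (-u)) ^ k := by
  rw [sub_eq_neg_add, add_pow]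
  refine Finset.sum_congr rfl fun n _ => ?_
  rw [← mul_neg, Real.exp_nat_mul, neg_pow (Real.exp (-u))]
  ring

lemma sum_choose_neg_one_pow {k : ℕ} (hk : k ≠ 0) :
    ∑ n ∈ Finset.range (k + 1), (k.choose n : ℝ) * (-1) ^ n = 0 := by
  have := Int.alternating_sum_range_choose_of_ne hk
  have h2 := congrArg (fun z : ℤ => (z : ℝ)) this
  push_cast at h2
  rw [← h2]
  exact Finset.sum_congr rfl fun n _ => by ring

/-- A difference of order `k ≥ 2` kills affine functions. For the linear part, `(n+1) binom(k+1,n+1)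
= (k+1) binom(k,n)` reduces to the alternating sum of one order less. -/
lemma sum_choose_neg_one_pow_mul_linear {k : ℕ} (hk : 2 ≤ k) (a b : ℝ) :
    ∑ n ∈ Finset.range (k + 1), (k.choose n : ℝ) * (-1) ^ n * (a + n * b) = 0 := by
  have h1 : ∑ n ∈ Finset.range (k + 1), (k.choose n : ℝ) * (-1) ^ n * n = 0 := by
    rw [Finset.sum_range_succ']
    obtain ⟨k, rfl⟩ : ∃ k', k = k' + 1 := ⟨k - 1, by omega⟩
    have := sum_choose_neg_one_pow (k := k) (by omega)
    calc _ = -((k : ℝ) + 1) * ∑ n ∈ Finset.range (k + 1), (k.choose n : ℝ) * (-1) ^ n := by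
          rw [Finset.mul_sum]
          simp only [Nat.cast_zero, mul_zero, add_zero]
          refine Finset.sum_congr rfl fun n _ => ?_
          have h := congrArg (fun z : ℕ => (z : ℝ)) (Nat.add_one_mul_choose_eq k n)
          push_cast at h
          push_cast
          rw [pow_succ]
          linear_combination (-1) ^ n * h
      _ = 0 := by rw [this, mul_zero]
  have h0 := sum_choose_neg_one_pow (k := k) (by omega)
  calc _ = a * ∑ n ∈ Finset.range (k + 1), (k.choose n : ℝ) * (-1) ^ n +
        b * ∑ n ∈ Finset.range (k + 1), (k.choose n : ℝ) * (-1) ^ n * n := by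
        rw [Finset.mul_sum, Finset.mul_sum, ← Finset.sum_add_distrib]
        exact Finset.sum_congr rfl fun n _ => by ring
    _ = 0 := by rw [h0, h1]; ring

/-- The linearized order statistics sum vanishes from the second order statistic on. -/
lemma orderStatSum_linear {Q q : ℕ} (hq : 2 ≤ q) (lam x : ℝ) :
    orderStatSum (fun u => 1 - u) Q q lam x = 0 := by
  rw [orderStatSum]
  refine mul_eq_zero_of_right _ (Finset.sum_eq_zero fun c _ => mul_eq_zero_of_right _ ?_)
  rw [← sum_choose_neg_one_pow_mul_linear (k := q + c) (by omega) 1 (-(x / lam))]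
  exact Finset.sum_congr rfl fun n _ => by ring

/-! ### Binomial tails and the distribution function of an order statistic. -/

/-- The probability that at least `q` of `Q` independent events of probability `F` occur. -/
def binomTail (Q q : ℕ) (F : ℝ) : ℝ :=
  ∑ k ∈ Finset.Ico q (Q + 1), (Q.choose k : ℝ) * F ^ k * (1 - F) ^ (Q - k)

/-- The derivative of the `k`-th term is `D k - D (k + 1)`, so the sum telescopes to `D q`; the
upper end `D (Q + 1)` is zero because its binomial coefficient is. -/
lemma hasDerivAt_binomTail {Q q : ℕ} (hqQ : q ≤ Q) (F : ℝ) :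
    HasDerivAt (binomTail Q q)
      ((q : ℝ) * Q.choose q * F ^ (q - 1) * (1 - F) ^ (Q - q)) F := by
  let D : ℕ → ℝ := fun k => (k : ℝ) * Q.choose k * F ^ (k - 1) * (1 - F) ^ (Q - k)
  have hterm : ∀ k ∈ Finset.Ico q (Q + 1), HasDerivAt
      (fun F : ℝ => (Q.choose k : ℝ) * F ^ k * (1 - F) ^ (Q - k)) (-(D (k + 1) - D k)) F := by
    intro k hk
    rw [Finset.mem_Ico] at hk
    have h1 : HasDerivAt (fun F : ℝ => (Q.choose k : ℝ) * F ^ k * (1 - F) ^ (Q - k))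
        ((Q.choose k : ℝ) * (k * F ^ (k - 1)) * (1 - F) ^ (Q - k) +
          (Q.choose k : ℝ) * F ^ k * (((Q - k : ℕ) : ℝ) * (1 - F) ^ (Q - k - 1) * (-1))) F :=
      ((hasDerivAt_pow k F).const_mul _).mul (((hasDerivAt_id F).const_sub 1).pow (Q - k))
    convert! h1 using 1
    have h := congrArg (fun z : ℕ => (z : ℝ)) (Nat.choose_succ_right_eq Q k)
    simp only [D, Nat.add_sub_cancel]
    rw [show Q - (k + 1) = Q - k - 1 by omega]
    push_cast at h ⊢
    linear_combination -(F ^ k * (1 - F) ^ (Q - k - 1)) * h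
  have hsum := HasDerivAt.fun_sum hterm
  rw [Finset.sum_neg_distrib, Finset.sum_Ico_sub _ (by omega)] at hsum
  convert! hsum using 1
  simp [D]

lemma iota_eq {Q q : ℕ} (hq : 1 ≤ q) (hqQ : q ≤ Q) : iota Q q = q * Q.choose q := by
  rw [iota, Nat.cast_choose ℝ hqQ, ← Nat.mul_factorial_pred (by omega : q ≠ 0)]
  have : (q : ℝ) ≠ 0 := by positivity
  push_cast
  field_simp

/-- Both sides vanish at `F = 0` and have the same derivative: expanding `(1 - F)^(Q - q)` and
integrating `F^(q - 1 + c)` produces the factor `1 / (q + c)`. -/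
lemma binomTail_eq_sum {Q q : ℕ} (hq : 1 ≤ q) (hqQ : q ≤ Q) (F : ℝ) :
    binomTail Q q F = iota Q q * ∑ c ∈ Finset.range (Q - q + 1),
      ((Q - q).choose c : ℝ) * ((-1) ^ c / ((q : ℝ) + c)) * F ^ (q + c) := by
  have hd : ∀ F : ℝ, HasDerivAt (fun F => iota Q q * ∑ c ∈ Finset.range (Q - q + 1),
      ((Q - q).choose c : ℝ) * ((-1) ^ c / ((q : ℝ) + c)) * F ^ (q + c))
      ((q : ℝ) * Q.choose q * F ^ (q - 1) * (1 - F) ^ (Q - q)) F := by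
    intro F
    have h := (HasDerivAt.fun_sum (u := Finset.range (Q - q + 1)) fun c _ =>
      (hasDerivAt_pow (q + c) F).const_mul
        (((Q - q).choose c : ℝ) * ((-1) ^ c / ((q : ℝ) + c)))).const_mul (iota Q q)
    convert! h using 1
    rw [iota_eq hq hqQ, mul_assoc ((q : ℝ) * _)]
    congr 1
    rw [sub_eq_neg_add, add_pow, Finset.mul_sum]
    refine Finset.sum_congr rfl fun c _ => ?_
    have : (q : ℝ) + c ≠ 0 := by positivity
    rw [show q + c - 1 = (q - 1) + c by omega, pow_add, neg_pow F]
    push_cast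
    field_simp
    simp
  have hdiff := is_const_of_deriv_eq_zero
    (f := fun F => binomTail Q q F - iota Q q * ∑ c ∈ Finset.range (Q - q + 1),
      ((Q - q).choose c : ℝ) * ((-1) ^ c / ((q : ℝ) + c)) * F ^ (q + c))
    (fun F => ((hasDerivAt_binomTail hqQ F).sub (hd F)).differentiableAt)
    (fun F => by rw [((hasDerivAt_binomTail hqQ F).fun_sub (hd F)).deriv, sub_self]) F 0
  have h0 : binomTail Q q 0 = 0 := Finset.sum_eq_zero fun k hk => by
    rw [Finset.mem_Ico] at hk
    rw [zero_pow (by omega)]; simp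
  have h1 : ∑ c ∈ Finset.range (Q - q + 1),
      ((Q - q).choose c : ℝ) * ((-1) ^ c / ((q : ℝ) + c)) * (0 : ℝ) ^ (q + c) = 0 :=
    Finset.sum_eq_zero fun c _ => by rw [zero_pow (by omega)]; simp
  simp only [h0, h1, mul_zero, sub_zero] at hdiff
  linarith

lemma orderStatSum_exp {Q q : ℕ} (hq : 1 ≤ q) (hqQ : q ≤ Q) (lam x : ℝ) :
    orderStatSum (fun u => Real.exp (-u)) Q q lam x =
      binomTail Q q (1 - Real.exp (-(x / lam))) := by
  rw [binomTail_eq_sum hq hqQ, orderStatSum]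
  congr 1
  refine Finset.sum_congr rfl fun c _ => ?_
  rw [← sum_choose_neg_one_pow_mul_exp]
  simp only [mul_div_assoc]

lemma binomTail_nonneg (Q q : ℕ) {F : ℝ} (h0 : 0 ≤ F) (h1 : F ≤ 1) : 0 ≤ binomTail Q q F :=
  Finset.sum_nonneg fun k _ => by have := sub_nonneg.2 h1; positivity

/-- A union bound over the `q`-subsets of trials. Algebraically, `binom(Q,q+k) ≤ binom(Q,q)
binom(Q-q,k)`, and with `binom(Q,q) F^q` factored out the rest is the total binomial mass of `Q - q`
trials. -/
lemma binomTail_le {Q q : ℕ} (hqQ : q ≤ Q) {F : ℝ} (h0 : 0 ≤ F) (h1 : F ≤ 1) :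
    binomTail Q q F ≤ Q.choose q * F ^ q := by
  have h1' := sub_nonneg.2 h1
  have hone : ∑ k ∈ Finset.range (Q - q + 1),
      F ^ k * (1 - F) ^ (Q - q - k) * ((Q - q).choose k : ℝ) = 1 := by
    rw [← add_pow]; simp
  rw [binomTail, Finset.sum_Ico_eq_sum_range, show Q + 1 - q = Q - q + 1 by omega,
    ← mul_one ((Q.choose q : ℝ) * F ^ q)]
  refine le_of_le_of_eq ?_ (congrArg _ hone)
  rw [Finset.mul_sum]
  refine Finset.sum_le_sum fun k hk => ?_
  have hk' : q + k ≤ Q := by rw [Finset.mem_range] at hk; omega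
  have hle : (Q.choose (q + k) : ℝ) ≤ Q.choose q * (Q - q).choose k := by
    have := Nat.choose_mul (n := Q) (Nat.le_add_right q k)
    rw [Nat.add_sub_cancel_left] at this
    rw [← Nat.cast_mul, ← this]
    exact_mod_cast Nat.le_mul_of_pos_right _ (Nat.choose_pos (Nat.le_add_right q k))
  rw [show Q - (q + k) = Q - q - k by omega, pow_add]
  calc _ = (Q.choose (q + k) : ℝ) * (F ^ q * F ^ k * (1 - F) ^ (Q - q - k)) := by ring
    _ ≤ (Q.choose q * (Q - q).choose k) * (F ^ q * F ^ k * (1 - F) ^ (Q - q - k)) := by gcongr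
    _ = _ := by ring

/-! ### The Erlang distribution. -/

/-- Distribution function of the sum of `n` independent exponential variables of rate `r`. -/
def erlangCDF (n : ℕ) (r x : ℝ) : ℝ :=
  1 - Real.exp (-(r * x)) * ∑ p ∈ Finset.range n, (r * x) ^ p / (p.factorial : ℝ)

@[fun_prop]
lemma continuous_erlangCDF (n : ℕ) (r : ℝ) : Continuous (erlangCDF n r) := by
  unfold erlangCDF; fun_prop

/-- Convolution with one more exponential density. Since `e^{-ry} e^{-r(x-y)} = e^{-rx}` does not
depend on `y`, the integrand is an exponential minus a constant times a polynomial in `x - y`, with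
an explicit antiderivative. -/
lemma integral_exp_mul_erlangCDF (n : ℕ) (r x : ℝ) :
    ∫ y in (0)..x, r * Real.exp (-(r * y)) * erlangCDF n r (x - y) = erlangCDF (n + 1) r x := by
  have hd : ∀ y ∈ Set.uIcc 0 x, HasDerivAt (fun y => -Real.exp (-(r * y)) + Real.exp (-(r * x)) *
      ∑ p ∈ Finset.range n, (r * (x - y)) ^ (p + 1) / ((p + 1).factorial : ℝ))
      (r * Real.exp (-(r * y)) * erlangCDF n r (x - y)) y := by
    intro y _
    have hp : ∀ p ∈ Finset.range n, HasDerivAt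
        (fun y => (r * (x - y)) ^ (p + 1) / ((p + 1).factorial : ℝ))
        (-r * ((r * (x - y)) ^ p / (p.factorial : ℝ))) y := by
      intro p _
      have h := ((((hasDerivAt_id y).const_sub x).const_mul r).pow (p + 1)).div_const
        ((p + 1).factorial : ℝ)
      convert! h using 1
      rw [Nat.factorial_succ]
      push_cast
      simp only [id]
      have : (p : ℝ) + 1 ≠ 0 := by positivity
      field_simp
    have h := hasDerivAt_neg_exp_mul_exp (r := r) (x := y) |>.add
      ((HasDerivAt.fun_sum hp).const_mul (Real.exp (-(r * x))))
    convert! h using 1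
    rw [erlangCDF, ← Finset.mul_sum,
      show -(r * x) = -(r * y) + -(r * (x - y)) by ring, Real.exp_add]
    ring
  rw [intervalIntegral.integral_eq_sub_of_hasDerivAt hd
    (Continuous.intervalIntegrable (by fun_prop) _ _), erlangCDF, Finset.sum_range_succ']
  simp
  ring

/-! ### Sums, blocks and order statistics of independent variables. -/

section Probability

variable {Ω : Type*} [MeasurableSpace Ω] {P : Measure Ω}

lemma measureReal_lt_of_map_eq_expMeasure {X : Ω → ℝ} (hX : Measurable X) {r : ℝ} (hr : 0 < r)
    (hlaw : P.map X = expMeasure r) {x : ℝ} (hx : 0 ≤ x) :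
    P.real {ω | X ω < x} = 1 - Real.exp (-(r * x)) := by
  have := isProbabilityMeasure_expMeasure hr
  have h1 : P.real {ω | X ω < x} = (expMeasure r).real (Set.Iio x) := by
    rw [← hlaw, map_measureReal_apply hX measurableSet_Iio]; rfl
  have hac : expMeasure r ≪ volume := withDensity_absolutelyContinuous _ _
  have h2 : (expMeasure r).real (Set.Iio x) = (expMeasure r).real (Set.Iic x) :=
    measureReal_congr (hac.ae_le Iio_ae_eq_Iic)
  rw [h1, h2, ← cdf_eq_real, cdf_expMeasure_eq hr, if_pos hx]

/-- Induction on the index set, integrating over the value `y` of the added variable. -/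
lemma measureReal_sum_lt [IsProbabilityMeasure P] {ι : Type*} [DecidableEq ι] {X : ι → Ω → ℝ} (hX : ∀ i, Measurable (X i))
    (hpos : ∀ i ω, 0 ≤ X i ω) (hindep : iIndepFun X P) {r : ℝ} (hr : 0 < r)
    (hlaw : ∀ i, P.map (X i) = expMeasure r) (s : Finset ι) {x : ℝ} (hx : 0 < x) :
    P.real {ω | ∑ i ∈ s, X i ω < x} = erlangCDF s.card r x := by
  induction s using Finset.induction_on generalizing x with
  | empty => simp [erlangCDF, hx]
  | insert i s his ih =>
    have := isProbabilityMeasure_expMeasure hr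
    have hT : Measurable (∑ j ∈ s, X j) := by
      simpa only [← Finset.sum_apply] using Finset.measurable_sum s fun j _ => hX j
    have hmap := (indepFun_iff_map_prod_eq_prod_map_map hT.aemeasurable (hX i).aemeasurable).1
      (hindep.indepFun_finsetSum_of_notMem hX his)
    have hpT : IsProbabilityMeasure (P.map (∑ j ∈ s, X j)) :=
      Measure.isProbabilityMeasure_map hT.aemeasurable
    have hB : MeasurableSet {p : ℝ × ℝ | p.1 + p.2 < x} :=
      measurableSet_lt (by fun_prop) (by fun_prop)
    have hset : P {ω | ∑ j ∈ insert i s, X j ω < x} =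
        ∫⁻ y, P {ω | ∑ j ∈ s, X j ω < x - y} ∂(expMeasure r) := by
      rw [show {ω | ∑ j ∈ insert i s, X j ω < x} =
        (fun ω => ((∑ j ∈ s, X j) ω, X i ω)) ⁻¹' {p : ℝ × ℝ | p.1 + p.2 < x} by
          ext ω; simp [Finset.sum_insert his, add_comm],
        ← Measure.map_apply (hT.prodMk (hX i)) hB, hmap, Measure.prod_apply_symm hB, hlaw]
      refine lintegral_congr fun y => ?_
      rw [Measure.map_apply hT (measurable_prodMk_right hB)]
      congr 1
      ext ω
      simp [lt_sub_iff_add_lt]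
    have hmono : Measurable fun y => P {ω | ∑ j ∈ s, X j ω < x - y} := by
      refine Antitone.measurable fun y z hyz => measure_mono fun ω hω => ?_
      exact lt_of_lt_of_le (show ∑ j ∈ s, X j ω < x - z from hω) (by linarith)
    have hpdf : Measurable (exponentialPDF r) := (measurable_exponentialPDFReal r).ennreal_ofReal
    have hint : ∫⁻ y, P {ω | ∑ j ∈ s, X j ω < x - y} ∂(expMeasure r) =
        ∫⁻ y in Set.Ioo 0 x,
          ENNReal.ofReal (r * Real.exp (-(r * y)) * erlangCDF s.card r (x - y)) := by
      rw [show expMeasure r = volume.withDensity (exponentialPDF r) from rfl,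
        lintegral_withDensity_eq_lintegral_mul _ hpdf hmono,
        ← lintegral_indicator measurableSet_Ioo]
      -- Outside `(0, x)` the integrand vanishes: the density is zero for `y < 0`, and for `y ≥ x` a
      -- nonnegative sum cannot lie below `x - y ≤ 0`. The point `y = 0` is null.
      have h0 : ∀ᵐ y : ℝ, y ≠ 0 := Measure.ae_ne volume 0
      refine lintegral_congr_ae ?_
      filter_upwards [h0] with y hy
      by_cases hyx : y ∈ Set.Ioo 0 x
      · rw [Set.indicator_of_mem hyx, Pi.mul_apply, exponentialPDF_of_nonneg hyx.1.le,
          ENNReal.ofReal_mul (mul_pos hr (Real.exp_pos _)).le, ← ih (sub_pos.2 hyx.2),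
          ofReal_measureReal]
      · rw [Set.indicator_of_notMem hyx, Pi.mul_apply]
        rcases lt_or_gt_of_ne hy with h | h
        · rw [exponentialPDF_of_neg h, zero_mul]
        · have hxy : x ≤ y := not_lt.1 fun h' => hyx ⟨h, h'⟩
          rw [show {ω | ∑ j ∈ s, X j ω < x - y} = ∅ by
            ext ω
            have := Finset.sum_nonneg fun j (_ : j ∈ s) => hpos j ω
            simp only [Set.mem_ofPred_eq, Set.mem_empty_iff_false, iff_false, not_lt]
            linarith]
          simp
    -- The Erlang factor is nonnegative because the induction hypothesis identifies it with a
    -- probability.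
    have hnn : 0 ≤ᵐ[volume.restrict (Set.Ioo 0 x)]
        fun y => r * Real.exp (-(r * y)) * erlangCDF s.card r (x - y) := by
      filter_upwards [ae_restrict_mem measurableSet_Ioo] with y hy
      rw [← ih (sub_pos.2 hy.2)]
      exact mul_nonneg (mul_pos hr (Real.exp_pos _)).le measureReal_nonneg
    rw [measureReal_def, hset, hint, Finset.card_insert_of_notMem his,
      ← integral_exp_mul_erlangCDF, intervalIntegral.integral_of_le hx.le,
      integral_Ioc_eq_integral_Ioo, integral_eq_lintegral_of_nonneg_ae hnn]
    exact Continuous.aestronglyMeasurable (by fun_prop)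


/-- Passes from independence of scalar entries to independence of rows, as needed for the `K` row
sums; each induction step splits off one row as a disjoint set of indices. -/
lemma iIndepFun.measureReal_forall_block {κ ν : Type*} [Fintype κ] [Fintype ν] [DecidableEq κ]
    [DecidableEq ν] [IsProbabilityMeasure P] {Y : κ × ν → Ω → ℝ} (hY : ∀ i, Measurable (Y i))
    (hindep : iIndepFun Y P) {B : κ → Set (ν → ℝ)} (hB : ∀ k, MeasurableSet (B k))
    (s : Finset κ) :
    P.real {ω | ∀ k ∈ s, (fun n => Y (k, n) ω) ∈ B k} =
      ∏ k ∈ s, P.real {ω | (fun n => Y (k, n) ω) ∈ B k} := by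
  induction s using Finset.induction_on with
  | empty => simp
  | insert i s his ih =>
    have hdisj : Disjoint (s ×ˢ (Finset.univ : Finset ν)) ({i} ×ˢ (Finset.univ : Finset ν)) := by
      rw [Finset.disjoint_left]
      rintro ⟨k, n⟩ h1 h2
      simp only [Finset.mem_product, Finset.mem_univ, and_true, Finset.mem_singleton] at h1 h2
      exact his (h2 ▸ h1)
    have h := hindep.indepFun_finset _ _ hdisj hY
    have hS : MeasurableSet {v : (s ×ˢ (Finset.univ : Finset ν) : Finset _) → ℝ |
        ∀ k : s, (fun n => v ⟨(k.1, n), by simp⟩) ∈ B k.1} := by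
      rw [Set.ofPred_forall]
      exact MeasurableSet.iInter fun k => (measurable_pi_lambda _ fun n =>
        measurable_pi_apply _) (hB k.1)
    have hT : MeasurableSet {v : ({i} ×ˢ (Finset.univ : Finset ν) : Finset _) → ℝ |
        (fun n => v ⟨(i, n), by simp⟩) ∈ B i} :=
      (measurable_pi_lambda _ fun n => measurable_pi_apply _) (hB i)
    have h2 := congrArg ENNReal.toReal (h.measure_inter_preimage_eq_mul _ _ hS hT)
    rw [ENNReal.toReal_mul] at h2
    rw [Finset.prod_insert his, ← ih, mul_comm]
    simp only [measureReal_def]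
    convert! h2 using 3
    · ext ω; simp [and_comm]
    · congr 1; ext ω; simp

lemma setOf_filter_eq {α ι : Type*} [Fintype ι] [DecidableEq ι] (X : ι → α → ℝ) (z : ℝ)
    (A : Finset ι) :
    {ω | Finset.univ.filter (fun i => X i ω < z) = A} =
      ⋂ i ∈ (Finset.univ : Finset ι), X i ⁻¹' (if i ∈ A then Set.Iio z else Set.Ici z) := by
  ext ω
  simp only [Set.mem_ofPred_eq, Finset.ext_iff, Finset.mem_filter, Finset.mem_univ, true_and,
    Set.mem_iInter, Set.mem_preimage, forall_true_left]
  refine forall_congr' fun i => ?_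
  by_cases hi : i ∈ A <;> simp [hi]

lemma measurableSet_filter_eq {ι : Type*} [Fintype ι] [DecidableEq ι] {X : ι → Ω → ℝ}
    (hX : ∀ i, Measurable (X i)) (z : ℝ) (A : Finset ι) :
    MeasurableSet {ω | Finset.univ.filter (fun i => X i ω < z) = A} := by
  rw [setOf_filter_eq]
  refine Finset.measurableSet_biInter _ fun i _ => hX i ?_
  split_ifs
  exacts [measurableSet_Iio, measurableSet_Ici]

lemma setOf_lt_card_filter {α ι : Type*} [Fintype ι] [DecidableEq ι] (X : ι → α → ℝ) (z : ℝ)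
    (m : ℕ) :
    {ω | m < (Finset.univ.filter (fun i => X i ω < z)).card} =
      ⋃ A ∈ Finset.univ.filter (fun A : Finset ι => m < A.card),
        {ω | Finset.univ.filter (fun i => X i ω < z) = A} := by
  ext ω; simp

/-- The number of occurrences among independent events of equal probability is binomial. -/
lemma measureReal_lt_card_filter [IsProbabilityMeasure P] {ι : Type*} [Fintype ι] [DecidableEq ι]
    {X : ι → Ω → ℝ} (hX : ∀ i, Measurable (X i)) (hindep : iIndepFun X P) {z F : ℝ}
    (hF : ∀ i, P.real {ω | X i ω < z} = F) (m : ℕ) :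
    P.real {ω | m < (Finset.univ.filter (fun i => X i ω < z)).card} =
      binomTail (Fintype.card ι) (m + 1) F := by
  have hA : ∀ A : Finset ι, P.real {ω | Finset.univ.filter (fun i => X i ω < z) = A} =
      F ^ A.card * (1 - F) ^ (Fintype.card ι - A.card) := by
    intro A
    have hF' : ∀ i, P.real (X i ⁻¹' Set.Ici z) = 1 - F := by
      intro i
      rw [← hF i, ← probReal_compl_eq_one_sub (measurableSet_lt (hX i) measurable_const)]
      congr 1
      ext ω
      simp
    have hF'' : ∀ i, P.real (X i ⁻¹' Set.Iio z) = F := hF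
    rw [setOf_filter_eq, measureReal_def, hindep.measure_inter_preimage_eq_mul, ENNReal.toReal_prod]
    · simp only [← measureReal_def]
      rw [Finset.prod_congr rfl fun i _ =>
        show P.real (X i ⁻¹' (if i ∈ A then Set.Iio z else Set.Ici z)) =
          if i ∈ A then F else 1 - F by split_ifs <;> simp [hF', hF'']]
      rw [Finset.prod_ite, Finset.prod_const, Finset.prod_const, Finset.filter_univ_mem,
        Finset.filter_not, Finset.filter_univ_mem, Finset.card_univ_sdiff]
    · intro i _
      split_ifs
      exacts [measurableSet_Iio, measurableSet_Ici]
  rw [setOf_lt_card_filter, measureReal_biUnion_finset]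
  · simp only [hA]
    -- The probability that exactly the events in `A` occur depends only on the cardinality of `A`,
    -- so the sum is grouped by cardinality.
    rw [Finset.sum_filter, ← Finset.powerset_univ,
      Finset.sum_powerset_apply_card (fun k => if m < k then
        F ^ k * (1 - F) ^ (Fintype.card ι - k) else 0), binomTail, Finset.card_univ,
      Finset.range_eq_Ico]
    symm
    refine Finset.sum_subset_zero_on_sdiff (Finset.Ico_subset_Ico_left (Nat.zero_le _)) ?_ ?_
    · intro k hk
      rw [if_neg, smul_zero]
      simp only [Finset.mem_sdiff, Finset.mem_Ico] at hk
      omega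
    · intro k hk
      rw [Finset.mem_Ico] at hk
      rw [if_pos (by omega), nsmul_eq_mul, mul_assoc]
  · intro A _ B _ hAB
    rw [Function.onFun, Set.disjoint_left]
    rintro ω h1 h2
    exact hAB (h1.symm.trans h2)
  · exact fun A _ => measurableSet_filter_eq hX z A

/-- After sorting, the entries below `z` form an initial segment, and a permutation preserves their
number. Ranks start at `0`, hence the strict inequality with `m`. -/
lemma sort_lt_iff {n : ℕ} (v : Fin n → ℝ) (m : Fin n) (z : ℝ) :
    v (Tuple.sort v m) < z ↔ (m : ℕ) < (Finset.univ.filter (fun i => v i < z)).card := by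
  rw [← Function.comp_apply (f := v),
    ← Tuple.lt_card_lt_iff_apply_lt_of_monotone (Tuple.monotone_sort v)]
  have : (Finset.univ.filter (fun i => (v ∘ Tuple.sort v) i < z)).card =
      (Finset.univ.filter (fun i => v i < z)).card :=
    Finset.card_equiv (Tuple.sort v) (by simp)
  rw [this]

/-- Sublevel sets are counting events, so measurability of the sorting permutation itself is not
needed. -/
lemma measurable_apply_sort {n : ℕ} (m : Fin n) :
    Measurable fun v : Fin n → ℝ => v (Tuple.sort v m) := by
  refine measurable_of_Iio fun z => ?_
  have : (fun v : Fin n → ℝ => v (Tuple.sort v m)) ⁻¹' Set.Iio z =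
      {v | (m : ℕ) < (Finset.univ.filter (fun i => v i < z)).card} := by
    ext v; exact sort_lt_iff v m z
  rw [this, setOf_lt_card_filter (fun i (v : Fin n → ℝ) => v i)]
  exact Finset.measurableSet_biUnion _ fun A _ =>
    measurableSet_filter_eq (fun i => measurable_pi_apply i) z A

lemma iIndepFun.indepFun_sum {ι κ : Type*} [Fintype ι] [Fintype κ] {Y : ι ⊕ κ → Ω → ℝ}
    (hY : ∀ i, Measurable (Y i)) (hindep : iIndepFun Y P) :
    IndepFun (fun ω i => Y (Sum.inl i) ω) (fun ω j => Y (Sum.inr j) ω) P := by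
  have hdisj : Disjoint ((Finset.univ : Finset ι).map Function.Embedding.inl)
      ((Finset.univ : Finset κ).map (Function.Embedding.inr (α := ι))) := by
    rw [Finset.disjoint_left]; simp
  exact (hindep.indepFun_finset _ _ hdisj hY).comp
    (φ := fun v i => v ⟨Sum.inl i, by simp⟩) (ψ := fun v j => v ⟨Sum.inr j, by simp⟩)
    (measurable_pi_lambda _ fun _ => measurable_pi_apply _)
    (measurable_pi_lambda _ fun _ => measurable_pi_apply _)

/-- Fubini for the product law of `(X, G)`: fix the value of `X`, then average over it. -/
lemma measureReal_le_and_lt_of_indepFun [IsProbabilityMeasure P] {X G : Ω → ℝ} (hX : Measurable X)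
    (hG : Measurable G) (hXG : IndepFun X G P) {φ : ℝ → ℝ} (hφ : Measurable φ) (a : ℝ) :
    P.real {ω | a ≤ X ω ∧ G ω < φ (X ω)} =
      ∫ ω in {ω | a ≤ X ω}, P.real {ω' | G ω' < φ (X ω)} ∂P := by
  have hmap := (indepFun_iff_map_prod_eq_prod_map_map hX.aemeasurable hG.aemeasurable).1 hXG
  have hpG : IsProbabilityMeasure (P.map G) := Measure.isProbabilityMeasure_map hG.aemeasurable
  have hpX : IsProbabilityMeasure (P.map X) := Measure.isProbabilityMeasure_map hX.aemeasurable
  have hB' : MeasurableSet {p : ℝ × ℝ | p.2 < φ p.1} :=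
    measurableSet_lt (by fun_prop) (by fun_prop)
  have hB : MeasurableSet {p : ℝ × ℝ | a ≤ p.1 ∧ p.2 < φ p.1} :=
    (measurableSet_le measurable_const measurable_fst).inter hB'
  have hS : MeasurableSet {ω | a ≤ X ω} := measurableSet_le measurable_const hX
  have hslice : Measurable fun x => P {ω' | G ω' < φ x} := by
    have := measurable_measure_prodMk_left (ν := P.map G) hB'
    simp only [Measure.map_apply hG (measurable_prodMk_left hB')] at this
    exact this
  have hleft : P {ω | a ≤ X ω ∧ G ω < φ (X ω)} =
      ∫⁻ ω in {ω | a ≤ X ω}, P {ω' | G ω' < φ (X ω)} ∂P := by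
    rw [show {ω | a ≤ X ω ∧ G ω < φ (X ω)} =
      (fun ω => (X ω, G ω)) ⁻¹' {p : ℝ × ℝ | a ≤ p.1 ∧ p.2 < φ p.1} from rfl,
      ← Measure.map_apply (hX.prodMk hG) hB, hmap, Measure.prod_apply hB,
      ← lintegral_indicator hS, lintegral_map (measurable_measure_prodMk_left hB) hX]
    refine lintegral_congr fun ω => ?_
    rw [Measure.map_apply hG (measurable_prodMk_left hB)]
    by_cases h : a ≤ X ω
    · rw [Set.indicator_of_mem (show ω ∈ {ω | a ≤ X ω} from h)]
      congr 1
      ext ω'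
      simp [h]
    · rw [Set.indicator_of_notMem (show ω ∉ {ω | a ≤ X ω} from h)]
      convert! measure_empty (μ := P)
      ext ω'
      simp [h]
  rw [measureReal_def, hleft, ← integral_toReal]
  · rfl
  · exact (hslice.comp hX).aemeasurable
  · exact ae_of_all _ fun ω => measure_lt_top _ _

end Probability

/-! ### Decoding failures as gain thresholds. -/

lemma logb_two_one_add_lt_iff {s R : ℝ} (hs : 0 ≤ s) :
    Real.logb 2 (1 + s) < R ↔ s < 2 ^ R - 1 := by
  rw [Real.logb_lt_iff_lt_rpow one_lt_two (by linarith), lt_sub_iff_add_lt, add_comm]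

namespace Network

variable {K N M : ℕ} (S : Network K N M)

lemma rho_pos : 0 < S.rho := by
  have := S.eta_pos
  have := S.beta_pos
  have := S.xi_pos
  have := S.psi_pos
  exact div_pos (by positivity) (sub_pos.2 S.balance)

lemma gam_pos (i : Fin (M + 1)) : 0 < S.gam i :=
  sub_pos.2 (Real.one_lt_rpow one_lt_two (S.target_pos i))

/-- Kept as a product, with no assumption on the sign of `1 - γ_0 ρ I_SI`, so that it serves the
feasible and the infeasible case alike. -/
lemma rateST_lt_iff {x : ℝ} (hx : 0 ≤ x) :
    S.rateST x < S.target 0 ↔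
      S.snr * x * ((1 - S.beta) * (1 - S.gam 0 * S.rho * S.ISI)) < S.gam 0 := by
  have hb := sub_pos.2 S.beta_lt
  have hs := S.snr_pos
  have hr := S.rho_pos
  have hI := S.ISI_nonneg
  have hden : 0 < (1 - S.beta) * S.rho * S.snr * S.ISI * x + 1 := by positivity
  rw [rateST, logb_two_one_add_lt_iff (by positivity), ← gam, div_lt_iff₀ hden]
  constructor <;> intro h <;> linarith

lemma rateRx_lt_iff (i : Fin (M + 1)) {x z : ℝ} (hx : 0 ≤ x) (hz : 0 ≤ z) :
    S.rateRx i x z < S.target i ↔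
      S.snr * x * z * (S.rho * (S.alpha i - ∑ k ∈ Finset.Ioi i, S.alpha k * S.gam i)) <
        S.gam i := by
  have hs := S.snr_pos
  have hr := S.rho_pos
  have ha := S.alpha_nonneg
  have hsum : 0 ≤ ∑ k ∈ Finset.Ioi i, S.alpha k := Finset.sum_nonneg fun k _ => ha k
  have hai := ha i
  rw [rateRx, ← Finset.sum_mul, ← Finset.sum_mul, ← Finset.sum_mul, ← Finset.sum_mul,
    ← Finset.sum_mul]
  rw [logb_two_one_add_lt_iff (by positivity), ← gam, div_lt_iff₀ (by positivity)]
  constructor <;> intro h <;> linarith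

variable {S}

lemma Feasible.mu_pos {m : Fin (M + 1)} (hf : S.Feasible m) : 0 < S.mu := by
  refine div_pos (S.gam_pos 0) (mul_pos (sub_pos.2 S.beta_lt) ?_)
  have := hf.1
  linarith

lemma Feasible.rateST_lt_iff {m : Fin (M + 1)} (hf : S.Feasible m) {x : ℝ} (hx : 0 ≤ x) :
    S.rateST x < S.target 0 ↔ x < S.mu / S.snr := by
  have h : 0 < (1 - S.beta) * (1 - S.gam 0 * S.rho * S.ISI) := by
    refine mul_pos (sub_pos.2 S.beta_lt) ?_
    have := hf.1
    linarith
  rw [S.rateST_lt_iff hx, ← lt_div_iff₀ h, lt_div_iff₀' S.snr_pos]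
  rfl

lemma Feasible.thetaAt_den_pos {m i : Fin (M + 1)} (hf : S.Feasible m) (hi : i ≤ m) :
    0 < S.rho * (S.alpha i - ∑ k ∈ Finset.Ioi i, S.alpha k * S.gam i) := by
  have := hf.2 i hi
  rw [← Finset.sum_mul]
  exact mul_pos S.rho_pos (by linarith)

lemma Feasible.theta_pos {m : Fin (M + 1)} (hf : S.Feasible m) : 0 < S.theta m :=
  (Finset.lt_sup'_iff _).2
    ⟨m, by simp, div_pos (S.gam_pos m) (hf.thetaAt_den_pos le_rfl)⟩

/-- Each failure is a threshold on `z`; some failure occurs exactly below the largest threshold. -/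
lemma Feasible.exists_rateRx_lt_iff {m : Fin (M + 1)} (hf : S.Feasible m) {x z : ℝ} (hx : 0 < x)
    (hz : 0 ≤ z) :
    (∃ i ≤ m, S.rateRx i x z < S.target i) ↔ z < S.theta m / (S.snr * x) := by
  rw [lt_div_iff₀' (mul_pos S.snr_pos hx), theta, Finset.lt_sup'_iff]
  refine exists_congr fun i => ?_
  rw [Finset.mem_Iic]
  refine and_congr_right fun hi => ?_
  rw [S.rateRx_lt_iff i hx.le hz, thetaAt, lt_div_iff₀ (hf.thetaAt_den_pos hi)]

variable {Ω : Type*} {h : Fin K → Ω → EuclideanSpace ℂ (Fin N)} {g : Fin (M + 1) → Ω → ℂ} {b : Ω → Fin K}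

/-- The family of all scalar channel gains. -/
def gains (h : Fin K → Ω → EuclideanSpace ℂ (Fin N)) (g : Fin (M + 1) → Ω → ℂ) :
    (Fin K × Fin N) ⊕ Fin (M + 1) → Ω → ℝ :=
  Sum.elim (fun p ω => ‖h p.1 ω p.2‖ ^ 2) (fun r ω => ‖g r ω‖ ^ 2)

lemma norm_sq_eq_sum_gains (k : Fin K) (ω : Ω) :
    ‖h k ω‖ ^ 2 = ∑ n, gains h g (Sum.inl (k, n)) ω :=
  EuclideanSpace.norm_sq_eq _

/-! ### Laws and independence of the two hop gains. -/

namespace RayleighModel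

variable [MeasurableSpace Ω] {P : Measure Ω}


lemma measurable_gains (hmodel : S.RayleighModel P h g b) (i) : Measurable (gains h g i) := by
  rcases i with ⟨k, n⟩ | r
  · have h1 : Measurable fun ω => h k ω n :=
      (EuclideanSpace.proj (𝕜 := ℂ) n).continuous.measurable.comp (hmodel.measurable_h k)
    exact h1.norm.pow_const 2
  · exact (hmodel.measurable_g r).norm.pow_const 2

lemma iIndepFun_gains (hmodel : S.RayleighModel P h g b) : iIndepFun (gains h g) P := by
  have := hmodel.indep.comp (fun _ z => ‖z‖ ^ 2) (fun _ => measurable_norm.pow_const 2)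
  convert! this using 1
  ext i ω
  rcases i with p | r <;> rfl

lemma bestGain_lt_iff (hmodel : S.RayleighModel P h g b) (ω : Ω) (a : ℝ) :
    bestGain h b ω < a ↔ ∀ k ∈ Finset.univ,
      (fun n => gains h g (Sum.inl (k, n)) ω) ∈ {v : Fin N → ℝ | ∑ n, v n < a} := by
  simp only [Set.mem_ofPred_eq, ← norm_sq_eq_sum_gains, Finset.mem_univ, forall_true_left]
  exact ⟨fun hb k => (hmodel.best ω k).trans_lt hb, fun hb => hb _⟩

/-- The selection `b` is not assumed measurable; maximality turns the sublevel sets into finite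
intersections of measurable sets. -/
lemma measurable_bestGain (hmodel : S.RayleighModel P h g b) : Measurable (bestGain h b) := by
  refine measurable_of_Iio fun a => ?_
  have : bestGain h b ⁻¹' Set.Iio a = ⋂ k, {ω | ‖h k ω‖ ^ 2 < a} := by
    ext ω
    simp only [Set.mem_preimage, Set.mem_Iio, Set.mem_iInter, Set.mem_ofPred_eq]
    exact ⟨fun hb k => (hmodel.best ω k).trans_lt hb, fun hb => hb _⟩
  rw [this]
  exact MeasurableSet.iInter fun k =>
    measurableSet_lt ((hmodel.measurable_h k).norm.pow_const 2) measurable_const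

lemma measurable_sortedGain (hmodel : S.RayleighModel P h g b) (m : Fin (M + 1)) :
    Measurable (sortedGain g m) :=
  (measurable_apply_sort m).comp (measurable_pi_lambda _ fun r => hmodel.measurable_gains (Sum.inr r))

/-- The first-hop and the second-hop gains are independent. -/
lemma indepFun_bestGain_sortedGain [IsProbabilityMeasure P] (hmodel : S.RayleighModel P h g b) (m : Fin (M + 1)) :
    IndepFun (bestGain h b) (sortedGain g m) P := by
  have hK : (Finset.univ : Finset (Fin K)).Nonempty := ⟨⟨0, S.K_pos⟩, Finset.mem_univ _⟩
  have h1 := iIndepFun.indepFun_sum hmodel.measurable_gains hmodel.iIndepFun_gains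
  -- The selected gain is the maximum of the row sums, a measurable function of the first-hop gains
  -- alone.
  have h2 := h1.comp (φ := fun v => Finset.univ.sup' hK fun k => ∑ n, v (k, n))
    (by
      convert! Finset.measurable_sup' hK (f := fun k (v : Fin K × Fin N → ℝ) => ∑ n, v (k, n))
        fun k _ => by fun_prop using 1
      ext v
      rw [Finset.sup'_apply]) (measurable_apply_sort m)
  convert! h2 using 1
  ext ω
  simp only [Function.comp_apply, ← norm_sq_eq_sum_gains]
  exact le_antisymm (Finset.le_sup' (fun k => ‖h k ω‖ ^ 2) (Finset.mem_univ (b ω)))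
    (Finset.sup'_le _ _ fun k _ => hmodel.best ω k)

lemma measureReal_bestGain_lt [IsProbabilityMeasure P] (hmodel : S.RayleighModel P h g b) {a : ℝ} (ha : 0 < a) :
    P.real {ω | bestGain h b ω < a} = erlangCDF N (1 / S.lamPS) a ^ K := by
  simp only [hmodel.bestGain_lt_iff]
  rw [iIndepFun.measureReal_forall_block (Y := fun p => gains h g (Sum.inl p))
    (B := fun _ => {v : Fin N → ℝ | ∑ n, v n < a})
    (fun p => hmodel.measurable_gains _)
    (hmodel.iIndepFun_gains.precomp Sum.inl_injective)
    (fun _ => measurableSet_lt (by fun_prop) measurable_const)]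
  rw [Finset.prod_eq_pow_card (b := erlangCDF N (1 / S.lamPS) a), Finset.card_fin]
  intro k _
  have := measureReal_sum_lt (P := P) (X := fun n => gains h g (Sum.inl (k, n)))
    (fun n => hmodel.measurable_gains _) (fun n ω => by simp only [gains, Sum.elim_inl]; positivity)
    (hmodel.iIndepFun_gains.precomp (g := fun n => Sum.inl (k, n)) fun _ _ h => by simpa using h)
    (one_div_pos.2 S.lamPS_pos) (fun n => hmodel.law_h k n) Finset.univ ha
  rw [Finset.card_fin] at this
  exact this

lemma measureReal_sortedGain_lt [IsProbabilityMeasure P] (hmodel : S.RayleighModel P h g b) (m : Fin (M + 1)) {z : ℝ}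
    (hz : 0 ≤ z) :
    P.real {ω | sortedGain g m ω < z} =
      orderStatSum (fun u => Real.exp (-u)) (M + 1) ((m : ℕ) + 1) S.lamSR z := by
  rw [orderStatSum_exp (by omega) (by omega)]
  have hset : {ω | sortedGain g m ω < z} = {ω | (m : ℕ) <
      (Finset.univ.filter (fun r => gains h g (Sum.inr r) ω < z)).card} := by
    ext ω
    exact sort_lt_iff (fun r => gains h g (Sum.inr r) ω) m z
  rw [hset, measureReal_lt_card_filter (X := fun r => gains h g (Sum.inr r))
    (fun r => hmodel.measurable_gains _)
    (hmodel.iIndepFun_gains.precomp Sum.inr_injective)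
    (fun r => measureReal_lt_of_map_eq_expMeasure (hmodel.measurable_gains (Sum.inr r))
      (one_div_pos.2 S.lamSR_pos) (hmodel.law_g r) hz), Fintype.card_fin]
  congr 4
  ring

end RayleighModel

/-- The gamma terms cancel in the sum over `n`, whatever their values; the first sum is the binomial
expansion of the `K`-th power of the Erlang distribution function. -/
lemma outageApprox_eq (S : Network K N M) {m : Fin (M + 1)} (hm : 1 ≤ (m : ℕ)) :
    S.outageApprox m = erlangCDF N (1 / S.lamPS) (S.mu / S.snr) ^ K := by
  rw [outageApprox]
  have hzero : ∀ y t : ℝ, ∀ c ∈ Finset.range (M + 1 - ((m : ℕ) + 1) + 1),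
      ∑ n ∈ Finset.range ((m : ℕ) + 1 + c + 1),
      ∑ l ∈ Finset.Icc 1 K, ∑ j ∈ Finset.range (l * (N - 1) + 1),
        (((M + 1 - ((m : ℕ) + 1)).choose c : ℝ) * (((m : ℕ) + 1 + c).choose n : ℝ) *
          (K.choose l : ℝ)) *
        ((-1) ^ (c + n + l) / ((((m : ℕ) + 1 : ℕ) : ℝ) + c)) * (coeffC N l j / (l : ℝ) ^ j) *
        (((j : ℝ) + n * t * l) * upperGamma j (l * y)
          - upperGamma ((j : ℝ) + 1) (l * y)
          - n * t * j * l * upperGamma ((j : ℝ) - 1) (l * y)) = 0 := by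
    intro y t c _
    -- Two exchanges make the sum over `n` innermost; there the bracket is `a + n b` with `a` and
    -- `b` free of `n`.
    rw [Finset.sum_comm]
    refine Finset.sum_eq_zero fun l _ => ?_
    rw [Finset.sum_comm]
    refine Finset.sum_eq_zero fun j _ => ?_
    rw [← mul_zero (((M + 1 - ((m : ℕ) + 1)).choose c : ℝ) * (K.choose l : ℝ) *
        ((-1) ^ (c + l) / ((((m : ℕ) + 1 : ℕ) : ℝ) + c)) * (coeffC N l j / (l : ℝ) ^ j)),
      ← sum_choose_neg_one_pow_mul_linear (k := (m : ℕ) + 1 + c) (by omega)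
        (j * upperGamma j (l * y) - upperGamma ((j : ℝ) + 1) (l * y))
        (t * l * upperGamma j (l * y) - t * j * l * upperGamma ((j : ℝ) - 1) (l * y)),
      Finset.mul_sum]
    refine Finset.sum_congr rfl fun n _ => ?_
    rw [show c + n + l = c + l + n by omega, pow_add _ (c + l) n]
    ring
  rw [Finset.sum_eq_zero (hzero _ _), mul_zero, add_zero, erlangCDF,
    show 1 / S.lamPS * (S.mu / S.snr) = S.mu / (S.lamPS * S.snr) by
      rw [div_mul_div_comm, one_mul],
    sub_eq_neg_add, add_pow]
  refine Finset.sum_congr rfl fun l _ => ?_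
  rw [← sum_pow_div_factorial_pow S.N_pos, neg_pow (_ * _), mul_pow (Real.exp _), ← Real.exp_nat_mul, one_pow, mul_neg]
  ring

/-! ### The exact outage probability. -/

lemma bestGain_nonneg (ω : Ω) : 0 ≤ bestGain h b ω := sq_nonneg _

lemma sortedGain_nonneg (m : Fin (M + 1)) (ω : Ω) : 0 ≤ sortedGain g m ω := sq_nonneg _

variable [MeasurableSpace Ω] {P : Measure Ω} [IsProbabilityMeasure P]

lemma RayleighModel.outageProb_eq_one (hmodel : S.RayleighModel P h g b) {m : Fin (M + 1)}
    (hf : ¬ S.Feasible m) : S.outageProb P h g b m = 1 := by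
  have hrate : ∀ a, MeasurableSet {ω | bestGain h b ω < a} := fun a =>
    measurableSet_lt hmodel.measurable_bestGain measurable_const
  by_cases h1 : S.gam 0 * (S.rho * S.ISI) < 1
  · obtain ⟨i, him, hi⟩ : ∃ i ≤ m, S.alpha i ≤ S.gam i * ∑ k ∈ Finset.Ioi i, S.alpha k := by
      by_contra! hcon
      exact hf ⟨h1, hcon⟩
    have hrx : ∀ ω, ∃ i ≤ m, S.rateRx i (bestGain h b ω) (sortedGain g m ω) < S.target i := by
      refine fun ω => ⟨i, him, ?_⟩
      rw [S.rateRx_lt_iff i (bestGain_nonneg ω) (sortedGain_nonneg m ω)]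
      refine lt_of_le_of_lt (mul_nonpos_of_nonneg_of_nonpos ?_ ?_) (S.gam_pos i)
      · exact mul_nonneg (mul_nonneg S.snr_pos.le (bestGain_nonneg ω)) (sortedGain_nonneg m ω)
      · refine mul_nonpos_of_nonneg_of_nonpos S.rho_pos.le ?_
        rw [← Finset.sum_mul]
        linarith
    have hmeas : MeasurableSet {ω | S.rateST (bestGain h b ω) < S.target 0} := by
      have hb := hmodel.measurable_bestGain
      simp only [S.rateST_lt_iff (bestGain_nonneg _)]
      exact measurableSet_lt (by fun_prop) measurable_const
    -- The receiver fails at every sample point, so the second outage event is the complement of the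
    -- first.
    have hcompl : {ω | S.target 0 ≤ S.rateST (bestGain h b ω) ∧
        ∃ i ≤ m, S.rateRx i (bestGain h b ω) (sortedGain g m ω) < S.target i} =
        {ω | S.rateST (bestGain h b ω) < S.target 0}ᶜ := by
      ext ω
      simp [hrx ω]
    rw [outageProb, hcompl, probReal_add_probReal_compl hmeas]
  · have hST : ∀ ω, S.rateST (bestGain h b ω) < S.target 0 := by
      intro ω
      rw [S.rateST_lt_iff (bestGain_nonneg ω)]
      refine lt_of_le_of_lt (mul_nonpos_of_nonneg_of_nonpos
        (mul_nonneg S.snr_pos.le (bestGain_nonneg ω))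
        (mul_nonpos_of_nonneg_of_nonpos (sub_pos.2 S.beta_lt).le ?_)) (S.gam_pos 0)
      linarith
    simp [outageProb, hST, not_le.2 (hST _)]

lemma RayleighModel.outageProb_eq (hmodel : S.RayleighModel P h g b) {m : Fin (M + 1)}
    (hf : S.Feasible m) : S.outageProb P h g b m =
      P.real {ω | bestGain h b ω < S.mu / S.snr} +
        ∫ ω in {ω | S.mu / S.snr ≤ bestGain h b ω},
          orderStatSum (fun u => Real.exp (-u)) (M + 1) ((m : ℕ) + 1) S.lamSR
            (S.theta m / (S.snr * bestGain h b ω)) ∂P := by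
  have ha : 0 < S.mu / S.snr := div_pos hf.mu_pos S.snr_pos
  have hset : {ω | S.target 0 ≤ S.rateST (bestGain h b ω) ∧
        ∃ i ≤ m, S.rateRx i (bestGain h b ω) (sortedGain g m ω) < S.target i} =
      {ω | S.mu / S.snr ≤ bestGain h b ω ∧
        sortedGain g m ω < S.theta m / (S.snr * bestGain h b ω)} := by
    ext ω
    simp only [Set.mem_ofPred_eq]
    rw [← not_lt, hf.rateST_lt_iff (bestGain_nonneg ω), not_lt]
    -- On this event the gain is at least `μ/snr > 0`, which makes the division by it legitimate.
    exact and_congr_right fun hX =>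
      hf.exists_rateRx_lt_iff (ha.trans_le hX) (sortedGain_nonneg m ω)
  rw [outageProb, hset,
    measureReal_le_and_lt_of_indepFun hmodel.measurable_bestGain (hmodel.measurable_sortedGain m)
      (hmodel.indepFun_bestGain_sortedGain m) (φ := fun x => S.theta m / (S.snr * x))
      (by fun_prop)]
  simp only [hf.rateST_lt_iff (bestGain_nonneg _)]
  congr 1
  refine setIntegral_congr_fun
    (measurableSet_le measurable_const hmodel.measurable_bestGain) fun ω _ => ?_
  exact hmodel.measureReal_sortedGain_lt m
    (div_nonneg hf.theta_pos.le (mul_nonneg S.snr_pos.le (bestGain_nonneg ω)))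

end Network

/-! ### Error bounds and the main theorem. -/

lemma orderStatSum_exp_nonneg {Q q : ℕ} (hq : 1 ≤ q) (hqQ : q ≤ Q) {lam x : ℝ}
    (hx : 0 ≤ x / lam) : 0 ≤ orderStatSum (fun u => Real.exp (-u)) Q q lam x := by
  rw [orderStatSum_exp hq hqQ]
  exact binomTail_nonneg _ _ (sub_nonneg.2 (Real.exp_le_one_iff.2 (by linarith)))
    (sub_le_self _ (Real.exp_pos _).le)

lemma orderStatSum_exp_le {Q q : ℕ} (hq : 1 ≤ q) (hqQ : q ≤ Q) {lam x : ℝ} (hx : 0 ≤ x / lam) :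
    orderStatSum (fun u => Real.exp (-u)) Q q lam x ≤ Q.choose q * (x / lam) ^ q := by
  rw [orderStatSum_exp hq hqQ]
  have h0 : 0 ≤ 1 - Real.exp (-(x / lam)) := sub_nonneg.2 (Real.exp_le_one_iff.2 (by linarith))
  refine (binomTail_le hqQ h0 (sub_le_self _ (Real.exp_pos _).le)).trans ?_
  gcongr
  linarith [Real.add_one_le_exp (-(x / lam))]

end CoopNOMA

end

theorem theorem2 {K N M : ℕ} {Ω : Type*} [MeasurableSpace Ω] (P : Measure Ω)
    [IsProbabilityMeasure P] (S : CoopNOMA.Network K N M)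
    (h : Fin K → Ω → EuclideanSpace ℂ (Fin N)) (g : Fin (M + 1) → Ω → ℂ) (b : Ω → Fin K)
    (hmodel : S.RayleighModel P h g b) (m : Fin (M + 1)) (hm : 1 ≤ (m : ℕ)) :
    (¬ S.Feasible m → S.outageProb P h g b m = 1) ∧
    (S.Feasible m →
      -- the exact outage probability
      S.outageProb P h g b m =
        P.real {ω | CoopNOMA.Network.bestGain h b ω < S.mu / S.snr} +
        ∫ ω in {ω | S.mu / S.snr ≤ CoopNOMA.Network.bestGain h b ω},
          CoopNOMA.orderStatSum (fun u => Real.exp (-u)) (M + 1) ((m : ℕ) + 1) S.lamSR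
            (S.theta m / (S.snr * CoopNOMA.Network.bestGain h b ω)) ∂P ∧
      -- the closed form is the same expression with `exp (-u)` replaced by `1 - u`
      S.outageApprox m =
        P.real {ω | CoopNOMA.Network.bestGain h b ω < S.mu / S.snr} +
        ∫ ω in {ω | S.mu / S.snr ≤ CoopNOMA.Network.bestGain h b ω},
          CoopNOMA.orderStatSum (fun u => 1 - u) (M + 1) ((m : ℕ) + 1) S.lamSR
            (S.theta m / (S.snr * CoopNOMA.Network.bestGain h b ω)) ∂P ∧
      -- the error of the approximation
      0 ≤ S.outageProb P h g b m - S.outageApprox m ∧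
      S.outageProb P h g b m - S.outageApprox m ≤
        ((M + 1).choose ((m : ℕ) + 1) : ℝ) *
          ∫ ω in {ω | S.mu / S.snr ≤ CoopNOMA.Network.bestGain h b ω},
            (S.theta m / (S.lamSR * (S.snr * CoopNOMA.Network.bestGain h b ω))) ^
              ((m : ℕ) + 1) ∂P ∧
      S.outageProb P h g b m - S.outageApprox m ≤
        ((M + 1).choose ((m : ℕ) + 1) : ℝ) *
          (S.theta m / (S.lamSR * S.mu)) ^ ((m : ℕ) + 1)) := by
  refine ⟨hmodel.outageProb_eq_one, fun hf => ?_⟩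
  have hmu := hf.mu_pos
  have hsnr := S.snr_pos
  have hlam := S.lamSR_pos
  have htheta := hf.theta_pos
  have ha : 0 < S.mu / S.snr := div_pos hmu hsnr
  have hX := hmodel.measurable_bestGain
  have hmeas : MeasurableSet {ω | S.mu / S.snr ≤ CoopNOMA.Network.bestGain h b ω} :=
    measurableSet_le measurable_const hX
  have happrox : S.outageApprox m = P.real {ω | CoopNOMA.Network.bestGain h b ω < S.mu / S.snr} :=
    (CoopNOMA.Network.outageApprox_eq S hm).trans (hmodel.measureReal_bestGain_lt ha).symm
  have hexact := hmodel.outageProb_eq hf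
  -- The closed form equals the first-hop probability, so the error is the entire second-hop term.
  have hdiff : S.outageProb P h g b m - S.outageApprox m =
      ∫ ω in {ω | S.mu / S.snr ≤ CoopNOMA.Network.bestGain h b ω},
        CoopNOMA.orderStatSum (fun u => Real.exp (-u)) (M + 1) ((m : ℕ) + 1) S.lamSR
          (S.theta m / (S.snr * CoopNOMA.Network.bestGain h b ω)) ∂P := by
    rw [hexact, happrox, add_sub_cancel_left]
  have harg : ∀ ω, 0 ≤ S.theta m / (S.snr * CoopNOMA.Network.bestGain h b ω) / S.lamSR := by
    intro ω
    have := CoopNOMA.Network.bestGain_nonneg (h := h) (b := b) ω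
    positivity
  -- On the event, `snr * X ≥ μ`; this gives both integrability and the final uniform bound.
  have hratio : ∀ ω ∈ {ω | S.mu / S.snr ≤ CoopNOMA.Network.bestGain h b ω},
      (S.theta m / (S.lamSR * (S.snr * CoopNOMA.Network.bestGain h b ω))) ^ ((m : ℕ) + 1) ≤
        (S.theta m / (S.lamSR * S.mu)) ^ ((m : ℕ) + 1) := by
    intro ω hω
    have hω' : S.mu / S.snr ≤ CoopNOMA.Network.bestGain h b ω := hω
    rw [div_le_iff₀' hsnr] at hω'
    have := CoopNOMA.Network.bestGain_nonneg (h := h) (b := b) ω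
    gcongr
  have hnonneg : ∀ ω, 0 ≤
      (S.theta m / (S.lamSR * (S.snr * CoopNOMA.Network.bestGain h b ω))) ^ ((m : ℕ) + 1) := by
    intro ω
    have := CoopNOMA.Network.bestGain_nonneg (h := h) (b := b) ω
    positivity
  have hint : IntegrableOn (fun ω =>
      (S.theta m / (S.lamSR * (S.snr * CoopNOMA.Network.bestGain h b ω))) ^ ((m : ℕ) + 1))
      {ω | S.mu / S.snr ≤ CoopNOMA.Network.bestGain h b ω} P := by
    refine Integrable.of_bound (Measurable.aestronglyMeasurable (by fun_prop))
      ((S.theta m / (S.lamSR * S.mu)) ^ ((m : ℕ) + 1)) ?_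
    filter_upwards [ae_restrict_mem hmeas] with ω hω
    rw [Real.norm_of_nonneg (hnonneg ω)]
    exact hratio ω hω
  have hbound : S.outageProb P h g b m - S.outageApprox m ≤
      ((M + 1).choose ((m : ℕ) + 1) : ℝ) *
        ∫ ω in {ω | S.mu / S.snr ≤ CoopNOMA.Network.bestGain h b ω},
          (S.theta m / (S.lamSR * (S.snr * CoopNOMA.Network.bestGain h b ω))) ^
            ((m : ℕ) + 1) ∂P := by
    rw [hdiff, ← integral_const_mul]
    refine integral_mono_of_nonneg
      (ae_of_all _ fun ω => CoopNOMA.orderStatSum_exp_nonneg (by omega) (by omega) (harg ω))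
      (hint.const_mul _) (ae_of_all _ fun ω => ?_)
    have := CoopNOMA.orderStatSum_exp_le (q := (m : ℕ) + 1) (Q := M + 1) (by omega) (by omega)
      (harg ω)
    rwa [div_div, mul_comm (_ * _) S.lamSR] at this
  refine ⟨hexact, ?_, ?_, hbound, hbound.trans ?_⟩
  -- The linearized integrand is zero since `m + 1 ≥ 2`.
  · simp only [CoopNOMA.orderStatSum_linear (show 2 ≤ (m : ℕ) + 1 by omega), integral_zero,
      add_zero, happrox]
  · rw [hdiff]
    exact integral_nonneg fun ω => CoopNOMA.orderStatSum_exp_nonneg (by omega) (by omega) (harg ω)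
  · gcongr
    refine (setIntegral_mono_on hint (integrable_const _) hmeas hratio).trans ?_
    -- The integral of the constant bound carries the probability of the event, which is at most
    -- one.
    rw [setIntegral_const, smul_eq_mul]
    exact mul_le_of_le_one_left (by positivity) measureReal_le_one
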